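/- Let $G$ be a finite simple connected graph on $n$ vertices with Laplacian matrix $L(G)=D-A$, where $D$ is the diagonal matrix of vertex degrees and $A$ the adjacency matrix. For integers $0<i<j\le n$ and $m\le n$ with $m\notin\{i,j\}$, say that $G$ realizes $S_{\{i,j\}_n^m}$ if the eigenvalues of $L(G)$, listed with multiplicity, are exactly $$S_{\{i,j\}_n^m}=\{0,1,\ldots,m-1,m,m,m+1,\ldots,n-1,n\}\setminus\{i,j\}$$ (a multiset in which $m$ occurs twice, the numbers $i$ and $j$ do not occur, and every other integer of $\{0,1,\ldots,n\}$ occurs once). Proposition. Suppose that $G$ realizes $S_{\{i,n\}_n^1}$ for some $i$ (so $1<i<n$, and the Laplacian spectrum of $G$ is $\{0,1,1,2,3,\ldots,n-1\}\setminus\{i\}$). Then: (a) $n\ge 9$; (b) $n$ is not a prime number; (c) $2\le\min_{v} d_v\le\max_{v} d_v\le n-3$, where $v$ runs over the vertices of $G$ and $d_v$ is the degree of $v$. -/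

import Mathlib

/-- The Laplacian spectrum of a finite simple graph: the eigenvalues of its Laplacian matrix
`D - A`, listed with multiplicity as the multiset of roots of the characteristic polynomial. The
matrix is real symmetric, so all `|V|` eigenvalues are real and none is lost. -/
noncomputable def laplacianSpectrum {V : Type*} [Fintype V] [DecidableEq V]
    (G : SimpleGraph V) [DecidableRel G.Adj] : Multiset ℝ :=
  (G.lapMatrix ℝ).charpoly.roots

/-- The multiset `S_{{i,j}_n^m} = {0, 1, …, m-1, m, m, m+1, …, n-1, n} \ {i, j}`: the numbers
`0, …, n` with `m` listed twice, and then every occurrence of `i` and of `j` removed. -/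
def doubledSet (n m i j : ℕ) : Multiset ℕ :=
  (m ::ₘ Multiset.range (n + 1)).filter (fun k => k ≠ i ∧ k ≠ j)

/-- The simple graph `G` realizes `S_{{i,j}_n^m}`, where `0 < i < j ≤ n` and `m ≤ n`: it is a
connected graph of order `n` whose Laplacian spectrum is `S_{{i,j}_n^m}`. Comparing the numbers of
elements, this is possible only if `m` is neither `i` nor `j`. -/
def RealizesDoubledSet {V : Type*} [Fintype V] [DecidableEq V]
    (G : SimpleGraph V) [DecidableRel G.Adj] (n m i j : ℕ) : Prop :=
  Fintype.card V = n ∧ 0 < i ∧ i < j ∧ j ≤ n ∧ m ≤ n ∧ G.Connected ∧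
    laplacianSpectrum G = (doubledSet n m i j).map (fun k : ℕ => (k : ℝ))

/-! Diagonal entries of `p(L)` are averages of `p(λ)` weighted by squared eigenvector coordinates.
With `p(x) = (x - 1)(x - M)`, `M` bounding the spectrum, only `λ = 0` can contribute positively,
with weight `1/n` by connectedness. For `M = n - 1` this bounds every degree `d` by `2 ≤ d ≤ n - 3`
(`SimpleGraph.Connected.degree_quadratic_le`). As in the matrix-tree theorem, `n` divides the
product of the nonzero eigenvalues; all are below `n`, so `n` is not prime
(`card_dvd_prod_erase_zero`). The degree bounds force `n ≥ 5`, so only 6 and 8 remain below 9; the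
traces of `L` and `L²` exclude them (`sum_sq_add_le_of_degree_mem_Icc`). -/

/-! ### Spectral weights and vertex degrees -/

section Spectral

open Matrix

variable {V : Type*} [Fintype V] [DecidableEq V]

/-- The diagonal entries of the powers of a real symmetric matrix, through its eigenvectors. -/
theorem Matrix.IsHermitian.pow_apply_self_eq_sum {A : Matrix V V ℝ} (hA : A.IsHermitian)
    (p : ℕ) (v : V) :
    (A ^ p) v v = ∑ k, hA.eigenvalues k ^ p * (hA.eigenvectorBasis k v) ^ 2 := by
  have h : A ^ p = Unitary.conjStarAlgAut ℝ _ hA.eigenvectorUnitary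
      (diagonal (hA.eigenvalues) ^ p) := by
    rw [map_pow]
    congr 1
    exact hA.spectral_theorem
  rw [h, Unitary.conjStarAlgAut_apply, diagonal_pow, Matrix.mul_apply]
  refine Finset.sum_congr rfl fun k _ => ?_
  rw [mul_diagonal, star_apply, hA.eigenvectorUnitary_apply, Pi.pow_apply]
  simp only [star_trivial]
  ring

theorem Matrix.IsHermitian.sum_sq_eigenvectorBasis {A : Matrix V V ℝ} (hA : A.IsHermitian)
    (k : V) : ∑ v, (hA.eigenvectorBasis k v) ^ 2 = 1 := by
  have h := hA.eigenvectorBasis.orthonormal.1 k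
  rw [EuclideanSpace.norm_eq, Real.sqrt_eq_one] at h
  simpa using h

theorem Matrix.IsHermitian.trace_pow_eq_sum {A : Matrix V V ℝ} (hA : A.IsHermitian) (p : ℕ) :
    ∑ v, (A ^ p) v v = ∑ k, hA.eigenvalues k ^ p := by
  simp_rw [hA.pow_apply_self_eq_sum p]
  rw [Finset.sum_comm]
  simp_rw [← Finset.mul_sum, hA.sum_sq_eigenvectorBasis, mul_one]

variable (G : SimpleGraph V) [DecidableRel G.Adj]

theorem SimpleGraph.lapMatrix_apply_self (v : V) : G.lapMatrix ℝ v v = G.degree v := by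
  simp [SimpleGraph.lapMatrix, SimpleGraph.degMatrix]

theorem SimpleGraph.lapMatrix_sq_apply_self (v : V) :
    (G.lapMatrix ℝ ^ 2) v v = (G.degree v : ℝ) ^ 2 + G.degree v := by
  have h (u : V) : G.lapMatrix ℝ v u * G.lapMatrix ℝ u v
      = (if v = u then (G.degree v : ℝ) ^ 2 else 0) + if G.Adj v u then 1 else 0 := by
    by_cases huv : v = u
    · subst huv
      simp [SimpleGraph.lapMatrix_apply_self, sq]
    · by_cases hadj : G.Adj v u <;>
        simp [SimpleGraph.lapMatrix, SimpleGraph.degMatrix, huv, Ne.symm huv, G.adj_comm u v, hadj]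
  rw [sq, Matrix.mul_apply, Finset.sum_congr rfl fun u _ => h u, Finset.sum_add_distrib,
    ← SimpleGraph.degree_eq_sum_if_adj]
  simp

variable {G}

/-- The unit eigenvectors of the Laplacian of a connected graph for the eigenvalue `0` are
constant. -/
theorem SimpleGraph.Connected.sq_eigenvectorBasis_of_eigenvalues_eq_zero (hG : G.Connected) (k v : V)
    (hk : (G.isHermitian_lapMatrix ℝ).eigenvalues k = 0) :
    ((G.isHermitian_lapMatrix ℝ).eigenvectorBasis k v) ^ 2 = 1 / Fintype.card V := by
  have h := (G.isHermitian_lapMatrix ℝ).mulVec_eigenvectorBasis k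
  rw [hk, zero_smul, G.lapMatrix_mulVec_eq_zero_iff_forall_reachable] at h
  have h1 := (G.isHermitian_lapMatrix ℝ).sum_sq_eigenvectorBasis k
  rw [Finset.sum_congr rfl fun u _ => by rw [h u v (hG.preconnected u v)]] at h1
  rw [Finset.sum_const, Finset.card_univ, nsmul_eq_mul] at h1
  exact eq_one_div_of_mul_eq_one_right h1

/-- If `0` is a simple Laplacian eigenvalue and the others lie in `[1, M]`, then each vertex degree
satisfies a quadratic inequality. -/
theorem SimpleGraph.Connected.degree_quadratic_le (hG : G.Connected) (M : ℝ)
    (h0 : ∑ k, (if (G.isHermitian_lapMatrix ℝ).eigenvalues k = 0 then (1 : ℝ) else 0) = 1)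
    (hM : ∀ k, (G.isHermitian_lapMatrix ℝ).eigenvalues k ≠ 0 →
      1 ≤ (G.isHermitian_lapMatrix ℝ).eigenvalues k ∧
        (G.isHermitian_lapMatrix ℝ).eigenvalues k ≤ M) (v : V) :
    (G.degree v : ℝ) ^ 2 - M * G.degree v + M * (1 - 1 / Fintype.card V) ≤ 0 := by
  set hA := G.isHermitian_lapMatrix ℝ
  have e0 := hA.pow_apply_self_eq_sum 0 v
  have e1 := hA.pow_apply_self_eq_sum 1 v
  have e2 := hA.pow_apply_self_eq_sum 2 v
  rw [pow_zero, Matrix.one_apply_eq] at e0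
  rw [pow_one, G.lapMatrix_apply_self] at e1
  rw [G.lapMatrix_sq_apply_self] at e2
  have key : ∑ k, (hA.eigenvalues k - 1) * (hA.eigenvalues k - M) * (hA.eigenvectorBasis k v) ^ 2
      ≤ ∑ k, (M / Fintype.card V) * (if hA.eigenvalues k = 0 then (1 : ℝ) else 0) := by
    refine Finset.sum_le_sum fun k _ => ?_
    by_cases hk : hA.eigenvalues k = 0
    · rw [hG.sq_eigenvectorBasis_of_eigenvalues_eq_zero k v hk, hk]
      simp [div_eq_mul_inv]
    · obtain ⟨h1, h2⟩ := hM k hk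
      rw [if_neg hk, mul_zero]
      exact mul_nonpos_of_nonpos_of_nonneg
        (mul_nonpos_of_nonneg_of_nonpos (by linarith) (by linarith)) (sq_nonneg _)
  rw [← Finset.mul_sum, h0, mul_one] at key
  have expand : ∑ k, (hA.eigenvalues k - 1) * (hA.eigenvalues k - M)
        * (hA.eigenvectorBasis k v) ^ 2
      = ((G.degree v : ℝ) ^ 2 + G.degree v) - (1 + M) * G.degree v + M * 1 := by
    rw [e2, e1, congrArg (M * ·) e0, Finset.mul_sum, Finset.mul_sum, ← Finset.sum_sub_distrib,
      ← Finset.sum_add_distrib]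
    exact Finset.sum_congr rfl fun k _ => by ring
  rw [expand] at key
  have : M * (1 - 1 / (Fintype.card V : ℝ)) = M - M / Fintype.card V := by ring
  linarith

end Spectral

/-! ### Divisibility of the linear coefficient -/

section Charpoly

open Matrix Polynomial

variable {V R : Type*} [Fintype V] [DecidableEq V] [CommRing R]

/-- If the row sums and column sums of a matrix vanish, then the linear coefficient of its
characteristic polynomial is divisible by the order of the matrix. -/
theorem Matrix.card_dvd_charpoly_coeff_one [Nonempty V] (A : Matrix V V R)
    (hrow : ∀ i, ∑ j, A i j = 0) (hcol : ∀ j, ∑ i, A i j = 0) :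
    (Fintype.card V : R) ∣ A.charpoly.coeff 1 := by
  obtain ⟨v⟩ := ‹Nonempty V›
  -- Adding all rows of `X - A` to row `v` makes that row constantly `X`, which factors out.
  have h1 : A.charpoly = X * ((charmatrix A).updateRow v fun _ => 1).det := by
    have h := (charmatrix A).det_updateRow_sum v fun _ => 1
    rw [one_smul] at h
    rw [Matrix.charpoly, ← h, ← det_updateRow_smul]
    congr 2
    ext1 j
    have hj : ∑ k, charmatrix A k j = X := by
      simp only [charmatrix_apply, Finset.sum_sub_distrib, diagonal_apply]
      rw [← map_sum, hcol]
      simp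
    rw [Finset.sum_apply]
    simpa using hj
  -- At `X = 0`, adding all columns to column `v` leaves there only the entry `n` in row `v`.
  have h2 := (((charmatrix A).updateRow v fun _ => 1).map (eval 0)).det_updateCol_sum v fun _ => 1
  have h3 : (fun k => ∑ j, (1 : R) • (((charmatrix A).updateRow v fun _ => 1).map (eval 0)) k j)
      = (Fintype.card V : R) • Pi.single v 1 := by
    ext1 k
    by_cases hk : k = v
    · subst hk
      simp
    · simp only [one_smul, map_apply, updateRow_ne hk, charmatrix_apply, diagonal_apply, eval_sub,
        eval_C, Finset.sum_sub_distrib, hrow, Pi.smul_apply, Pi.single_eq_of_ne hk]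
      simp [apply_ite (eval (0 : R))]
  rw [h3, det_updateCol_smul, one_smul] at h2
  rw [h1, coeff_X_mul, coeff_zero_eq_eval_zero, ← coe_evalRingHom, RingHom.map_det]
  exact ⟨_, h2.symm⟩

end Charpoly

/-! ### Consequences of an integral Laplacian spectrum -/

section LaplacianSpectrum

open Matrix Polynomial

variable {V : Type*} [Fintype V] [DecidableEq V] {G : SimpleGraph V} [DecidableRel G.Adj]
  {D : Multiset ℕ}

theorem map_eigenvalues_eq_of_laplacianSpectrum_eq
    (h : laplacianSpectrum G = D.map (fun k : ℕ => (k : ℝ))) :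
    Finset.univ.val.map (G.isHermitian_lapMatrix ℝ).eigenvalues = D.map (fun k : ℕ => (k : ℝ)) := by
  rw [← h, laplacianSpectrum, (G.isHermitian_lapMatrix ℝ).roots_charpoly_eq_eigenvalues]
  rfl

theorem sum_eigenvalues_eq_of_laplacianSpectrum_eq
    (h : laplacianSpectrum G = D.map (fun k : ℕ => (k : ℝ))) (f : ℝ → ℝ) :
    ∑ k, f ((G.isHermitian_lapMatrix ℝ).eigenvalues k) = (D.map fun k : ℕ => f k).sum := by
  have h' := congrArg (fun s => (s.map f).sum) (map_eigenvalues_eq_of_laplacianSpectrum_eq h)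
  simp only [Multiset.map_map] at h'
  exact h'

theorem exists_mem_eigenvalues_eq_of_laplacianSpectrum_eq
    (h : laplacianSpectrum G = D.map (fun k : ℕ => (k : ℝ))) (v : V) :
    ∃ a ∈ D, (G.isHermitian_lapMatrix ℝ).eigenvalues v = a := by
  have hv : (G.isHermitian_lapMatrix ℝ).eigenvalues v ∈ D.map (fun k : ℕ => (k : ℝ)) := by
    rw [← map_eigenvalues_eq_of_laplacianSpectrum_eq h]
    exact Multiset.mem_map_of_mem _ (Finset.mem_univ_val v)
  obtain ⟨a, ha, hav⟩ := Multiset.mem_map.1 hv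
  exact ⟨a, ha, hav.symm⟩

theorem charpoly_lapMatrix_int_of_laplacianSpectrum_eq
    (h : laplacianSpectrum G = D.map (fun k : ℕ => (k : ℝ))) :
    (G.lapMatrix ℤ).charpoly = (D.map fun k : ℕ => X - C (k : ℤ)).prod := by
  apply Polynomial.map_injective (Int.castRingHom ℝ) Int.cast_injective
  have hmap : (G.lapMatrix ℤ).map (Int.castRingHom ℝ) = G.lapMatrix ℝ := by
    ext u v
    simp only [SimpleGraph.lapMatrix, SimpleGraph.degMatrix, Matrix.map_apply, Matrix.sub_apply, diagonal_apply,
      SimpleGraph.adjMatrix_apply, map_sub]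
    split_ifs <;> simp
  rw [← charpoly_map, hmap, (G.isHermitian_lapMatrix ℝ).splits_charpoly.eq_prod_roots_of_monic
    (charpoly_monic _), ← laplacianSpectrum, h, Multiset.map_map, Polynomial.map_multiset_prod,
    Multiset.map_map]
  simp

/-- The number of vertices divides the product of the nonzero Laplacian eigenvalues. -/
theorem card_dvd_prod_erase_zero [Nonempty V]
    (h : laplacianSpectrum G = D.map (fun k : ℕ => (k : ℝ))) (h0 : 0 ∈ D) :
    (Fintype.card V : ℤ) ∣ ((D.erase 0).map fun k : ℕ => -(k : ℤ)).prod := by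
  have hrow (u : V) : ∑ v, G.lapMatrix ℤ u v = 0 := by
    have := congrFun (G.lapMatrix_mulVec_const_eq_zero (R := ℤ)) u
    simpa [mulVec, dotProduct] using this
  have hcol (u : V) : ∑ v, G.lapMatrix ℤ v u = 0 := by
    rw [← hrow u]
    exact Finset.sum_congr rfl fun v _ => (G.isSymm_lapMatrix (R := ℤ)).apply u v
  have hdvd := (G.lapMatrix ℤ).card_dvd_charpoly_coeff_one hrow hcol
  rw [charpoly_lapMatrix_int_of_laplacianSpectrum_eq h, ← Multiset.cons_erase h0,
    Multiset.map_cons, Multiset.prod_cons, Nat.cast_zero, C_0, sub_zero, coeff_X_mul,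
    coeff_zero_multiset_prod, Multiset.map_map] at hdvd
  simpa [Function.comp_def] using hdvd

theorem not_prime_card_of_laplacianSpectrum_eq [Nonempty V]
    (h : laplacianSpectrum G = D.map (fun k : ℕ => (k : ℝ))) (h0 : D.count 0 = 1)
    (hlt : ∀ k ∈ D, k < Fintype.card V) : ¬ (Fintype.card V).Prime := by
  intro hp
  have h0mem : 0 ∈ D := Multiset.count_pos.1 (by omega)
  obtain ⟨k, hk, hdvd⟩ := (Nat.prime_iff_prime_int.1 hp).exists_mem_multiset_map_dvd
    (card_dvd_prod_erase_zero h h0mem)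
  rw [dvd_neg, Int.natCast_dvd_natCast] at hdvd
  have hk0 : k = 0 := Nat.eq_zero_of_dvd_of_lt hdvd (hlt k (Multiset.mem_of_mem_erase hk))
  subst hk0
  have := Multiset.count_pos.2 hk
  rw [Multiset.count_erase_self] at this
  omega

/-- If the Laplacian spectrum consists of a simple eigenvalue `0` and integers in `[1, M]`, then
each vertex degree satisfies a quadratic inequality. -/
theorem degree_quadratic_le_of_laplacianSpectrum_eq (hG : G.Connected)
    (h : laplacianSpectrum G = D.map (fun k : ℕ => (k : ℝ))) (h0 : D.count 0 = 1)
    {M : ℕ} (hM : ∀ k ∈ D, k ≤ M) (v : V) :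
    (Fintype.card V : ℤ) * (G.degree v : ℤ) ^ 2 - Fintype.card V * M * G.degree v
      + M * (Fintype.card V - 1) ≤ 0 := by
  have hcount : ∑ k, (if (G.isHermitian_lapMatrix ℝ).eigenvalues k = 0 then (1 : ℝ) else 0) = 1 := by
    rw [sum_eigenvalues_eq_of_laplacianSpectrum_eq h fun x => if x = 0 then 1 else 0,
      ← Multiset.cons_erase (Multiset.count_pos.1 (by omega : 0 < D.count 0)), Multiset.map_cons,
      Multiset.sum_cons, Multiset.map_congr (g := fun _ => (0 : ℝ)) rfl fun k hk => if_neg ?_]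
    · simp
    · rw [Nat.cast_eq_zero]
      rintro rfl
      have := Multiset.count_pos.2 hk
      rw [Multiset.count_erase_self] at this
      omega
  have key := hG.degree_quadratic_le M hcount (fun k hk => by
    obtain ⟨a, ha, hka⟩ := exists_mem_eigenvalues_eq_of_laplacianSpectrum_eq h k
    rw [hka] at hk ⊢
    rw [Nat.cast_ne_zero] at hk
    exact ⟨by exact_mod_cast Nat.one_le_iff_ne_zero.2 hk, by exact_mod_cast hM a ha⟩) v
  have hpos : (0 : ℝ) < Fintype.card V := by exact_mod_cast Fintype.card_pos_iff.2 ⟨v⟩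
  have : (Fintype.card V : ℝ) * (G.degree v : ℝ) ^ 2 - Fintype.card V * M * G.degree v
      + M * (Fintype.card V - 1) ≤ 0 := by
    have e : (Fintype.card V : ℝ) * (G.degree v : ℝ) ^ 2 - Fintype.card V * M * G.degree v
        + M * (Fintype.card V - 1) = Fintype.card V *
        ((G.degree v : ℝ) ^ 2 - M * G.degree v + M * (1 - 1 / Fintype.card V)) := by
      field_simp
    rw [e]
    exact mul_nonpos_of_nonneg_of_nonpos hpos.le key
  exact_mod_cast this

theorem sum_degree_of_laplacianSpectrum_eq
    (h : laplacianSpectrum G = D.map (fun k : ℕ => (k : ℝ))) :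
    ∑ v, G.degree v = D.sum := by
  have h1 := (G.isHermitian_lapMatrix ℝ).trace_pow_eq_sum 1
  rw [sum_eigenvalues_eq_of_laplacianSpectrum_eq h fun x => x ^ 1] at h1
  simp_rw [pow_one, G.lapMatrix_apply_self] at h1
  have h2 : (D.sum : ℝ) = (D.map fun k : ℕ => (k : ℝ)).sum := Nat.cast_multiset_sum D
  rw [← h2] at h1
  exact_mod_cast h1

theorem sum_degree_sq_add_degree_of_laplacianSpectrum_eq
    (h : laplacianSpectrum G = D.map (fun k : ℕ => (k : ℝ))) :
    ∑ v, (G.degree v ^ 2 + G.degree v) = (D.map (· ^ 2)).sum := by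
  have h1 := (G.isHermitian_lapMatrix ℝ).trace_pow_eq_sum 2
  rw [sum_eigenvalues_eq_of_laplacianSpectrum_eq h fun x => x ^ 2] at h1
  simp_rw [G.lapMatrix_sq_apply_self] at h1
  have h2 : (((D.map (· ^ 2)).sum : ℕ) : ℝ) = (D.map fun k : ℕ => (k : ℝ) ^ 2).sum := by
    rw [Nat.cast_multiset_sum, Multiset.map_map]
    simp
  rw [← h2] at h1
  exact_mod_cast h1

/-- If all degrees lie in `[2, b]`, then the first two moments of the Laplacian spectrum satisfy
an inequality. -/
theorem sum_sq_add_le_of_degree_mem_Icc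
    (h : laplacianSpectrum G = D.map (fun k : ℕ => (k : ℝ))) {b : ℕ}
    (hb : ∀ v, 2 ≤ G.degree v ∧ G.degree v ≤ b) :
    (D.map (· ^ 2)).sum + 2 * b * Fintype.card V ≤ (b + 3) * D.sum := by
  rw [← sum_degree_of_laplacianSpectrum_eq h, ← sum_degree_sq_add_degree_of_laplacianSpectrum_eq h,
    Finset.mul_sum, mul_comm _ (Fintype.card V), ← smul_eq_mul (Fintype.card V), ← Finset.card_univ,
    ← Finset.sum_const, ← Finset.sum_add_distrib]
  refine Finset.sum_le_sum fun v _ => ?_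
  obtain ⟨h1, h2⟩ := hb v
  -- This is `(d - 2)(b - d) ≥ 0` for a single vertex.
  nlinarith [Nat.mul_le_mul h1 h2, mul_nonneg (sub_nonneg.2 (Nat.cast_le (α := ℤ).2 h1))
    (sub_nonneg.2 (Nat.cast_le (α := ℤ).2 h2))]

theorem card_of_laplacianSpectrum_eq
    (h : laplacianSpectrum G = D.map (fun k : ℕ => (k : ℝ))) : D.card = Fintype.card V := by
  have := congrArg Multiset.card (map_eigenvalues_eq_of_laplacianSpectrum_eq h)
  simpa using this.symm

end LaplacianSpectrum

/-! ### The prescribed multiset and the final case check -/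

section DoubledSet

theorem count_zero_doubledSet {n m i j : ℕ} (hm : m ≠ 0) (hi : i ≠ 0) (hj : j ≠ 0) :
    (doubledSet n m i j).count 0 = 1 := by
  rw [doubledSet, Multiset.count_filter_of_pos ⟨hi.symm, hj.symm⟩,
    Multiset.count_cons_of_ne hm.symm]
  exact Multiset.count_eq_one_of_mem (Multiset.nodup_range _) (Multiset.mem_range.2 n.succ_pos)

theorem le_of_mem_doubledSet {n m i k : ℕ} (hm : m < n) (hk : k ∈ doubledSet n m i n) :
    k ≤ n - 1 := by
  simp only [doubledSet, Multiset.mem_filter, Multiset.mem_cons, Multiset.mem_range] at hk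
  omega

end DoubledSet

theorem proposition3p4 {V : Type*} [Fintype V] [DecidableEq V]
    (G : SimpleGraph V) [DecidableRel G.Adj] (n i : ℕ)
    (hG : RealizesDoubledSet G n 1 i n) :
    9 ≤ n ∧ ¬ n.Prime ∧
      2 ≤ G.minDegree ∧ G.minDegree ≤ G.maxDegree ∧ (G.maxDegree : ℤ) ≤ (n : ℤ) - 3 := by
  obtain ⟨rfl, hi, hin, -, -, hconn, hspec⟩ := hG
  have : Nonempty V := hconn.nonempty
  have h0 := count_zero_doubledSet (n := Fintype.card V) one_ne_zero hi.ne' (hi.trans hin).ne'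
  have hle : ∀ k ∈ doubledSet (Fintype.card V) 1 i (Fintype.card V), k ≤ Fintype.card V - 1 :=
    fun k hk => le_of_mem_doubledSet (by omega) hk
  have hprime : ¬ (Fintype.card V).Prime :=
    not_prime_card_of_laplacianSpectrum_eq hspec h0 fun k hk => by have := hle k hk; omega
  have hdeg (v : V) : 2 ≤ G.degree v ∧ G.degree v + 3 ≤ Fintype.card V := by
    -- With `M = n - 1` this reads `d(n - 1 - d) ≥ n - 2 + 1/n`, while `d = 1` and `d = n - 2` give
    -- exactly `n - 2`.
    have hq := degree_quadratic_le_of_laplacianSpectrum_eq hconn hspec h0 hle v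
    have hlt := G.degree_lt_card_verts v
    obtain ⟨N, hN⟩ : ∃ N, Fintype.card V = N + 2 := ⟨Fintype.card V - 2, by omega⟩
    rw [hN] at hq hlt ⊢
    push_cast [show N + 2 - 1 = N + 1 from rfl] at hq
    generalize G.degree v = d at hq hlt
    constructor
    · by_contra! hd
      interval_cases d <;> push_cast at hq <;> nlinarith
    · by_contra! hd
      obtain rfl | rfl : d = N ∨ d = N + 1 := by omega
      all_goals push_cast at hq; nlinarith
  have hmin : 2 ≤ G.minDegree := G.le_minDegree_of_forall_le_degree 2 fun v => (hdeg v).1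
  have hmax : G.maxDegree ≤ Fintype.card V - 3 :=
    G.maxDegree_le_of_forall_degree_le _ fun v => by have := (hdeg v).2; omega
  have hcard5 : 5 ≤ Fintype.card V := by
    have := hdeg (Classical.arbitrary V)
    omega
  refine ⟨?_, hprime, hmin, G.minDegree_le_maxDegree, by omega⟩
  by_contra! hlt
  have hmoment := sum_sq_add_le_of_degree_mem_Icc hspec (b := Fintype.card V - 3) fun v =>
    ⟨(hdeg v).1, by have := (hdeg v).2; omega⟩
  have hcard := card_of_laplacianSpectrum_eq hspec
  have hquad (M : ℕ) := degree_quadratic_le_of_laplacianSpectrum_eq hconn hspec h0 (M := M)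
  have hmoment4 := sum_sq_add_le_of_degree_mem_Icc hspec (b := 4)
  generalize hn : Fintype.card V = n at *
  obtain rfl | rfl | rfl | rfl : n = 5 ∨ n = 6 ∨ n = 7 ∨ n = 8 := by omega
  · exact hprime (by norm_num)
  · clear hquad hmoment4
    interval_cases i <;> revert hcard hmoment <;> decide
  · exact hprime (by norm_num)
  · obtain hi7 | rfl : i < 7 ∨ i = 7 := by omega
    · clear hquad hmoment4
      interval_cases i <;> revert hcard hmoment <;> decide
    -- For `n = 8`, `i = 7` the bound `b = 5` gives no contradiction. But the largest eigenvalue is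
    -- now 6, and `M = 6` rules out degree 5, so `b = 4` is allowed and the moments fail: 156 > 154.
    · have := hmoment4 fun v => ⟨(hdeg v).1, by
        have hq := hquad 6 (by decide) v
        have := (hdeg v).2
        by_contra! hd
        obtain h5 : G.degree v = 5 := by omega
        rw [h5] at hq
        norm_num at hq⟩
      revert this
      decide
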